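/- Let $E$ be a real or complex Banach space with a Schauder basis $(e_i)_{i\in\mathbb N}$. For $x\in E$ let $\mathrm{supp}(x)$ be the set of indices at which the basis expansion of $x$ has a non-zero coefficient; for $k\in\mathbb N$ write $k<x$ if $k<\min \mathrm{supp}(x)$, and write $x<y$ if $\max\mathrm{supp}(x)<\min\mathrm{supp}(y)$ (for non-zero finitely supported $x,y$). Let $bb(e_i)\subseteq E^{\mathbb N}$ be the set of infinite normalised block sequences, i.e. sequences $(x_i)$ of norm-one vectors in the (non-closed) linear span of $(e_i)$ with $x_0<x_1<x_2<\cdots$. In the infinite asymptotic game, players I and II alternate, I beginning: I plays natural numbers $n_0,n_1,n_2,\ldots$ and II plays norm-one vectors $x_0<x_1<x_2<\cdots$ in the linear span of $(e_i)$ with $n_i<x_i$ for all $i$. The outcome is the sequence $(x_i)_{i\in\mathbb N}$, and II has a strategy to play in a set $\mathcal B\subseteq bb(e_i)$ if II can always play, according to the rules and as a function of the previous moves of I, so that the outcome belongs to $\mathcal B$ whatever I plays. For $(x_i),(y_i)\in bb(e_i)$ write $(x_i)\sim(y_i)$ if the map $x_i\mapsto y_i$ extends to a linear isomorphism $T$ of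 $\overline{\mathrm{span}}(x_i)$ onto $\overline{\mathrm{span}}(y_i)$, and $(x_i)\sim_K(y_i)$ if moreover $\|T\|\cdot\|T^{-1}\|\le K$. Suppose that $\mathcal A\subseteq bb(e_i)$ is analytic (as a subset of the Polish space $E^{\mathbb N}$) and that II has a strategy to play in $$\mathcal A_\sim=\{(x_i)\in bb(e_i) : \exists (y_i)\in\mathcal A\;\ (x_i)\sim(y_i)\}.$$ Then there is a real number $K\ge 1$ such that II has a strategy to play in $$\mathcal A_K=\{(x_i)\in bb(e_i) : \exists (y_i)\in\mathcal A\;\ (x_i)\sim_K(y_i)\}.$$ -/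

import Mathlib

open MeasureTheory

namespace AsymptoticGame

variable {𝕜 X : Type*} [RCLike 𝕜] [NormedAddCommGroup X] [NormedSpace 𝕜 X]

/-- The support of a vector with respect to the basis `b = (e_i)`. It is finite for vectors in the
linear span of the basis. -/
def supp (b : SchauderBasis 𝕜 X) (x : X) : Set ℕ :=
  {i | b.coord i x ≠ 0}

/-- `k < x`: the number `k` lies strictly below the support of `x`. -/
def NatBelow (b : SchauderBasis 𝕜 X) (k : ℕ) (x : X) : Prop :=
  ∀ i ∈ supp b x, k < i

/-- `x < y`: the support of `x` lies strictly below the support of `y`. -/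
def VecBelow (b : SchauderBasis 𝕜 X) (x y : X) : Prop :=
  ∀ i ∈ supp b x, ∀ j ∈ supp b y, i < j

/-- `bb(e_i)`: the set of infinite normalised block sequences, i.e. the sequences of norm-one
vectors of the (non-closed) linear span of the basis with successive supports. -/
def bb (b : SchauderBasis 𝕜 X) : Set (ℕ → X) :=
  {x | (∀ i, x i ∈ Submodule.span 𝕜 (Set.range b)) ∧ (∀ i, ‖x i‖ = 1) ∧
    ∀ i, VecBelow b (x i) (x (i + 1))}

/-- `(n, x)` is a (complete) run of the infinite asymptotic game that respects the rules:
I plays natural numbers `n i`, II plays normalised vectors `x 0 < x 1 < ⋯` of the linear span of the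
basis, with `n i < x i`. -/
def IsRun (b : SchauderBasis 𝕜 X) (n : ℕ → ℕ) (x : ℕ → X) : Prop :=
  x ∈ bb b ∧ ∀ i, NatBelow b (n i) (x i)

/-- The sequence of vectors played by II when II follows `σ` and I plays `n 0, n 1, …`:
the `i`-th vector is the answer `σ [n 0, …, n i]`. -/
def outcome (σ : List ℕ → X) (n : ℕ → ℕ) (i : ℕ) : X :=
  σ ((List.range (i + 1)).map n)

/-- Player II has a strategy in the infinite asymptotic game to play in `A`. -/
def IIHasStrategy (b : SchauderBasis 𝕜 X) (A : Set (ℕ → X)) : Prop :=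
  ∃ σ : List ℕ → X, ∀ n : ℕ → ℕ, IsRun b n (outcome σ n) ∧ outcome σ n ∈ A

variable (𝕜) in
/-- The closed linear span `[x_i]`. -/
def closedSpan (x : ℕ → X) : Submodule 𝕜 X :=
  (Submodule.span 𝕜 (Set.range x)).topologicalClosure

variable (𝕜) in
theorem mem_closedSpan (x : ℕ → X) (i : ℕ) : x i ∈ closedSpan 𝕜 x :=
  Submodule.le_topologicalClosure _ (Submodule.subset_span ⟨i, rfl⟩)

variable (𝕜) in
/-- `(x_i) ∼ (y_i)`: the map `x_i ↦ y_i` extends to an isomorphism of the closed linear spans. -/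
def SeqEquiv (x y : ℕ → X) : Prop :=
  ∃ T : closedSpan 𝕜 x ≃L[𝕜] closedSpan 𝕜 y,
    ∀ i, T ⟨x i, mem_closedSpan 𝕜 x i⟩ = ⟨y i, mem_closedSpan 𝕜 y i⟩

variable (𝕜) in
/-- `(x_i) ∼_K (y_i)`: the map `x_i ↦ y_i` extends to an isomorphism `T` of the closed linear spans
with `‖T‖ * ‖T⁻¹‖ ≤ K`. -/
def SeqEquivConst (K : ℝ) (x y : ℕ → X) : Prop :=
  ∃ T : closedSpan 𝕜 x ≃L[𝕜] closedSpan 𝕜 y,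
    (∀ i, T ⟨x i, mem_closedSpan 𝕜 x i⟩ = ⟨y i, mem_closedSpan 𝕜 y i⟩) ∧
    ‖(T : closedSpan 𝕜 x →L[𝕜] closedSpan 𝕜 y)‖ *
      ‖(T.symm : closedSpan 𝕜 y →L[𝕜] closedSpan 𝕜 x)‖ ≤ K

/-- `A_∼`. -/
def saturation (b : SchauderBasis 𝕜 X) (A : Set (ℕ → X)) : Set (ℕ → X) :=
  {x | x ∈ bb b ∧ ∃ y ∈ A, SeqEquiv 𝕜 x y}

/-- `A_K`. -/
def saturationConst (b : SchauderBasis 𝕜 X) (K : ℝ) (A : Set (ℕ → X)) : Set (ℕ → X) :=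
  {x | x ∈ bb b ∧ ∃ y ∈ A, SeqEquivConst 𝕜 K x y}

end AsymptoticGame

namespace AsymptoticGame

open Filter Topology

/-! Parametrise the analytic set by a continuous `F` on Baire space. A play `f` of I against `σ` has
witnesses: a digit bounding the equivalence constant, followed by a code for a member of the set.
Equivalence with a fixed bound is a closed condition (`isClosed_normEquivWith`), so plays and their
witnesses form a closed relation. Call a set of plays large at a position if I cannot force the play
out of it by imposing lower bounds. When a large set is a countable union, II can reach, in finitely
many moves, a position where one piece is large (`IsLarge.reach`). Applied once, this gives a
position `t` and a first digit `K`; iterated, it lets II build both `f` and a witness starting with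
`K`, the pair lying in the relation by closedness (`exists_laver_strategy`). In the real game II
feeds `t` and then such an `f` to `σ`. The vectors answering `t` may violate I's actual bounds, so
basis vectors replace them; this costs a factor depending only on the length of `t` and the basis
(`normEquivWith_of_eventually_eq`). -/

/-- The initial segment `[f 0, …, f (n - 1)]` of a sequence. -/
def initSeg (f : ℕ → ℕ) (n : ℕ) : List ℕ := (List.range n).map f

@[simp] theorem length_initSeg (f : ℕ → ℕ) (n : ℕ) : (initSeg f n).length = n := by
  simp [initSeg]

theorem initSeg_succ (f : ℕ → ℕ) (n : ℕ) : initSeg f (n + 1) = initSeg f n ++ [f n] := by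
  simp [initSeg, List.range_succ]

theorem initSeg_congr {f g : ℕ → ℕ} {n : ℕ} (h : ∀ i < n, f i = g i) :
    initSeg f n = initSeg g n := by
  simpa [initSeg] using h

theorem getElem_initSeg (f : ℕ → ℕ) {n i : ℕ} (h : i < (initSeg f n).length) :
    (initSeg f n)[i] = f i := by
  simp [initSeg]

theorem getD_initSeg (f : ℕ → ℕ) {n i : ℕ} (h : i < n) : (initSeg f n).getD i 0 = f i := by
  simp [initSeg, h]

theorem initSeg_eq_iff {f : ℕ → ℕ} {t : List ℕ} :
    initSeg f t.length = t ↔ ∀ i (h : i < t.length), f i = t[i] := by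
  constructor
  · intro h i hi
    have := getD_initSeg f hi
    rw [h] at this
    simpa [hi] using this.symm
  · intro h
    refine List.ext_getElem (by simp) fun i h₁ h₂ => ?_
    rw [getElem_initSeg, h i h₂]

theorem eq_of_initSeg_eq {f g : ℕ → ℕ} {n i : ℕ} (h : initSeg f n = initSeg g n) (hi : i < n) :
    f i = g i := by
  rw [← getD_initSeg f hi, h, getD_initSeg g hi]

theorem take_initSeg (f : ℕ → ℕ) {m n : ℕ} (h : m ≤ n) :
    (initSeg f n).take m = initSeg f m := by
  refine List.ext_getElem (by simp [h]) fun i h₁ h₂ => ?_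
  simp [getElem_initSeg]

/-- A chain of finite sequences of unbounded length has a limit. -/
theorem exists_limit_of_chain (L : ℕ → List ℕ) (hL : ∀ i, L i <+: L (i + 1))
    (hlen : ∀ m, ∃ i, m ≤ (L i).length) : ∃ w : ℕ → ℕ, ∀ i, initSeg w (L i).length = L i := by
  have mono : ∀ i j, i ≤ j → L i <+: L j := fun i j h =>
    Nat.le_induction (List.prefix_refl _) (fun k _ ih => ih.trans (hL k)) j h
  choose ι hι using fun m => hlen (m + 1)
  refine ⟨fun m => (L (ι m))[m]'(hι m), fun i => initSeg_eq_iff.2 fun m hm => ?_⟩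
  rcases le_total i (ι m) with h | h
  · exact ((mono _ _ h).getElem hm).symm
  · exact (mono _ _ h).getElem (hι m)

/-! ### Large sets and countable unions -/

/-- Player I, choosing the lower bounds `φ`, cannot force the play out of `B` from `t` on. -/
def IsLarge (B : Set (ℕ → ℕ)) (t : List ℕ) : Prop :=
  ∀ φ : List ℕ → ℕ, ∃ f ∈ B, initSeg f t.length = t ∧
    ∀ n, t.length ≤ n → φ (initSeg f n) ≤ f n

theorem isLarge_univ (t : List ℕ) : IsLarge Set.univ t := by
  intro φ
  let s : ℕ → List ℕ := fun i => Nat.rec t (fun _ l => l ++ [φ l]) i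
  have hs : ∀ i, s (i + 1) = s i ++ [φ (s i)] := fun _ => rfl
  have hlen : ∀ i, (s i).length = t.length + i := by
    intro i
    induction i with
    | zero => rfl
    | succ i ih => rw [hs, List.length_append, ih]; rfl
  obtain ⟨f, hf⟩ := exists_limit_of_chain s (fun i => by rw [hs]; exact List.prefix_append _ _)
    (fun m => ⟨m, by rw [hlen]; omega⟩)
  refine ⟨f, trivial, hf 0, fun n hn => ?_⟩
  obtain ⟨i, rfl⟩ := Nat.exists_eq_add_of_le hn
  have h1 := hf i
  have h2 := hf (i + 1)
  rw [hlen (i + 1), ← add_assoc, initSeg_succ, ← hlen, h1, hs] at h2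
  rw [← hlen, h1]
  have h3 : f (s i).length = φ (s i) := by simpa using List.append_cancel_left h2
  exact h3.ge

/-- Otherwise I bounds the next move by `N` and then follows a winning `φ k` chosen according to
that move `k`. -/
theorem IsLarge.exists_isLarge_append {B : Set (ℕ → ℕ)} {t : List ℕ} (h : IsLarge B t) (N : ℕ) :
    ∃ k, N ≤ k ∧ IsLarge B (t ++ [k]) := by
  by_contra! hcon
  have : ∀ k, ∃ φ : List ℕ → ℕ, N ≤ k → ∀ f ∈ B, initSeg f (t ++ [k]).length = t ++ [k] →
      ∃ n, (t ++ [k]).length ≤ n ∧ f n < φ (initSeg f n) := by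
    intro k
    by_cases hk : N ≤ k
    · have := hcon k hk
      unfold IsLarge at this
      push Not at this
      obtain ⟨φ, hφ⟩ := this
      exact ⟨φ, fun _ => hφ⟩
    · exact ⟨0, fun h => absurd h hk⟩
  choose φ hφ using this
  -- `getD` recovers the move made at `t`; at `t` itself it returns a default, but there only the
  -- bound `N` is used.
  obtain ⟨f, hfB, hft, hf⟩ := h fun s => max N (φ (s.getD t.length 0) s)
  have hN : N ≤ f t.length := (le_max_left _ _).trans (hf _ le_rfl)
  obtain ⟨n, hn, hlt⟩ := hφ _ hN f hfB (by simp [initSeg_succ, hft])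
  simp only [List.length_append, List.length_singleton] at hn
  have := (le_max_right _ _).trans (hf n (by omega))
  rw [getD_initSeg f (by omega)] at this
  omega

/-- Player II, answering above the bounds chosen by player I, can reach `W` in finitely many
moves. -/
inductive Reach (W : Set (List ℕ)) : List ℕ → Prop
  | base {t : List ℕ} (h : t ∈ W) : Reach W t
  | step {t : List ℕ} (next : ℕ → ℕ) (hnext : ∀ N, N ≤ next N)
      (h : ∀ N, Reach W (t ++ [next N])) : Reach W t

theorem Reach.nonempty {W : Set (List ℕ)} {t : List ℕ} (h : Reach W t) : W.Nonempty := by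
  induction h with
  | base h => exact ⟨_, h⟩
  | step _ _ _ ih => exact ih 0

/-- Otherwise I can stay outside `Reach` and simultaneously defeat every `D k`: a single bound can
dominate finitely many at each move, and every pair of starting prefix and index is eventually
included. -/
theorem IsLarge.reach {B : Set (ℕ → ℕ)} {D : ℕ → Set (ℕ → ℕ)} (hB : B ⊆ ⋃ k, D k) {t : List ℕ}
    (h : IsLarge B t) : Reach {s | ∃ k, IsLarge (D k) s} t := by
  by_contra hcon
  set W : Set (List ℕ) := {s | ∃ k, IsLarge (D k) s}
  have h1 : ∀ s, ∃ N, ¬ Reach W s → ∀ k, N ≤ k → ¬ Reach W (s ++ [k]) := by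
    intro s
    by_cases hs : Reach W s
    · exact ⟨0, fun h => absurd hs h⟩
    · by_contra! hc
      choose k hk using fun N => (hc N).2
      exact hs (.step k (fun N => (hk N).1) fun N => (hk N).2)
  choose ψ hψ using h1
  have h2 : ∀ s k, ∃ φ : List ℕ → ℕ, ¬ Reach W s → ∀ f ∈ D k, initSeg f s.length = s →
      ∃ n, s.length ≤ n ∧ f n < φ (initSeg f n) := by
    intro s k
    by_cases hs : IsLarge (D k) s
    · exact ⟨0, fun h => absurd (.base ⟨k, hs⟩) h⟩
    · unfold IsLarge at hs
      push Not at hs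
      obtain ⟨φ, hφ⟩ := hs
      exact ⟨φ, fun _ => hφ⟩
  choose φ hφ using h2
  obtain ⟨f, hfB, hft, hf⟩ := h fun r => max (ψ r)
    ((Finset.range (r.length + 1) ×ˢ Finset.range (r.length + 1)).sup
      fun p => φ (r.take p.1) p.2 r)
  have hnr : ∀ n, t.length ≤ n → ¬ Reach W (initSeg f n) := by
    intro n hn
    induction n, hn using Nat.le_induction with
    | base => rwa [hft]
    | succ n hn ih =>
      rw [initSeg_succ]
      exact hψ _ ih _ ((le_max_left _ _).trans (hf n hn))
  obtain ⟨k, hk⟩ := Set.mem_iUnion.1 (hB hfB)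
  -- As `r ≥ k`, the pair `(r, k)` enters the supremum at every stage `n ≥ r`.
  set r := max k t.length
  obtain ⟨n, hn, hlt⟩ := hφ (initSeg f r) k (hnr r (le_max_right _ _)) f hk (by simp)
  rw [length_initSeg] at hn
  have hle := (le_max_right _ _).trans (hf n ((le_max_right _ _).trans hn))
  have hkn : k ≤ n := (le_max_left _ _).trans hn
  have := (Finset.le_sup (f := fun p : ℕ × ℕ => φ ((initSeg f n).take p.1) p.2 (initSeg f n))
    (show (r, k) ∈ _ from Finset.mk_mem_product (Finset.mem_range.2 (by simp; omega))
      (Finset.mem_range.2 (by simp; omega)))).trans hle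
  simp only [take_initSeg f hn] at this
  omega

/-! ### Building a play and its witness together -/

/-- A well-founded plan by which player II reaches a target set: stop and record a number, or
answer the next move `N` by `next N` and continue with `sub N`. -/
inductive Plan : Type
  | done (k : ℕ) : Plan
  | go (next : ℕ → ℕ) (sub : ℕ → Plan) : Plan

/-- Following the plan from `t`, player II reaches a position where `D k` is large, `k` being the
number recorded by the plan. -/
def Plan.Valid (D : ℕ → Set (ℕ → ℕ)) : Plan → List ℕ → Prop
  | .done k, t => IsLarge (D k) t
  | .go next sub, t => ∀ N, N ≤ next N ∧ (sub N).Valid D (t ++ [next N])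

theorem Reach.exists_plan {D : ℕ → Set (ℕ → ℕ)} {t : List ℕ}
    (h : Reach {s | ∃ k, IsLarge (D k) s} t) : ∃ P : Plan, P.Valid D t := by
  induction h with
  | base h => exact ⟨.done h.choose, h.choose_spec⟩
  | step next hnext _ ih =>
    choose P hP using ih
    exact ⟨.go next P, fun N => ⟨hnext N, hP N⟩⟩

/-- A state of player II's strategy: the position `pos`, the part `wit` of the witness that is
already fixed, and a plan for finding the next digit of the witness. -/
structure GameState where
  pos : List ℕ
  wit : List ℕ
  plan : Plan

/-- The plan of the state is valid for the sections `D`. -/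
def GameState.Valid (D : List ℕ → Set (ℕ → ℕ)) (s : GameState) : Prop :=
  s.plan.Valid (fun k => D (s.wit ++ [k])) s.pos

/-- The new witness digits are recorded exactly when the plan is completed. -/
def GameState.Progress (N : ℕ) (s s' : GameState) : Prop :=
  match s.plan with
  | .done k => s'.wit = s.wit ++ [k]
  | .go _ sub => s'.wit = s.wit ∧ s'.plan = sub N

theorem GameState.Progress.wit_prefix {N : ℕ} {s s' : GameState} (h : s.Progress N s') :
    s.wit <+: s'.wit := by
  obtain ⟨pos, wit, _ | _⟩ := s
  · simp only [Progress] at h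
    rw [h]
    exact List.prefix_append _ _
  · simp only [Progress] at h
    rw [h.1]

variable {D : List ℕ → Set (ℕ → ℕ)}

theorem IsLarge.exists_valid (hD : ∀ u, D u ⊆ ⋃ k, D (u ++ [k])) {u t : List ℕ}
    (h : IsLarge (D u) t) : ∃ P : Plan, (GameState.mk t u P).Valid D :=
  (h.reach (hD u)).exists_plan

theorem GameState.Valid.exists_next (hD : ∀ u, D u ⊆ ⋃ k, D (u ++ [k])) {s : GameState}
    (h : s.Valid D) (N : ℕ) : ∃ (s' : GameState) (k : ℕ), s'.Valid D ∧
      N ≤ k ∧ s'.pos = s.pos ++ [k] ∧ s.Progress N s' := by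
  obtain ⟨pos, wit, k | ⟨next, sub⟩⟩ := s
  · obtain ⟨m, hm, hl⟩ := IsLarge.exists_isLarge_append h N
    obtain ⟨P, hP⟩ := hl.exists_valid hD
    exact ⟨_, m, hP, hm, rfl, rfl⟩
  · exact ⟨⟨pos ++ [next N], wit, sub N⟩, next N, (h N).2, (h N).1, rfl, rfl, rfl⟩

theorem Plan.Valid.nonempty {E : Set (ℕ → ℕ)} {D : ℕ → Set (ℕ → ℕ)} (hE : ∀ k, D k ⊆ E)
    (P : Plan) {t : List ℕ} (h : P.Valid D t) : ∃ f ∈ E, initSeg f t.length = t := by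
  induction P generalizing t with
  | done k =>
    obtain ⟨f, hf, hft, -⟩ := h 0
    exact ⟨f, hE k hf, hft⟩
  | go next sub ih =>
    obtain ⟨f, hf, hft⟩ := ih 0 (h 0).2
    refine ⟨f, hf, ?_⟩
    simp only [List.length_append, List.length_singleton, initSeg_succ] at hft
    exact (List.append_inj' hft rfl).1

/-- If `D u` is large at `t`, then player II can answer above the bounds of player I so that the
resulting sequence `f` has a witness `w` all of whose initial segments are compatible with `f`. -/
theorem exists_strategy_of_isLarge (hD : ∀ u, D u = ⋃ k, D (u ++ [k])) {u t : List ℕ}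
    (h : IsLarge (D u) t) : ∃ g : List ℕ → ℕ, ∀ N : ℕ → ℕ, ∃ f w : ℕ → ℕ,
      initSeg f t.length = t ∧ initSeg w u.length = u ∧
      (∀ i, f (t.length + i) = g (initSeg N (i + 1))) ∧ (∀ i, N i ≤ f (t.length + i)) ∧
      ∀ m, ∃ i, m ≤ i ∧ ∃ j, m ≤ j ∧ ∃ f' ∈ D (initSeg w j), initSeg f' i = initSeg f i := by
  have hD' : ∀ u, D u ⊆ ⋃ k, D (u ++ [k]) := fun u => (hD u).subset
  obtain ⟨P, hP⟩ := h.exists_valid hD'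
  let S := {s : GameState // s.Valid D}
  choose nxt k hval hk hpos hprog using fun (s : S) N => s.2.exists_next hD' N
  let step : S → ℕ → S := fun s N => ⟨nxt s N, hval s N⟩
  let s₀ : S := ⟨⟨t, u, P⟩, hP⟩
  -- Each step appends II's answer to `pos`, so after a move of I the last entry is the answer.
  refine ⟨fun l => (l.foldl step s₀).1.pos.getLastD 0, fun N => ?_⟩
  let st : ℕ → S := fun i => (initSeg N i).foldl step s₀
  have hst : ∀ i, st (i + 1) = step (st i) (N i) := fun i => by
    simp [st, initSeg_succ]
  have hposs : ∀ i, (st (i + 1)).1.pos = (st i).1.pos ++ [k (st i) (N i)] := fun i => by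
    rw [hst]; exact hpos _ _
  have hlen : ∀ i, (st i).1.pos.length = t.length + i := by
    intro i
    induction i with
    | zero => rfl
    | succ i ih => rw [hposs, List.length_append, ih]; rfl
  have hpr : ∀ i, (st i).1.Progress (N i) (st (i + 1)).1 := fun i => by
    rw [hst]; exact hprog _ _
  -- Plans are well-founded, so each is completed and infinitely many digits are recorded.
  have hdone : ∀ (Q : Plan) i, (st i).1.plan = Q →
      ∃ j, i ≤ j ∧ (st j).1.wit.length < (st (j + 1)).1.wit.length := by
    intro Q
    induction Q with
    | done k =>
      intro i hi
      have := hpr i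
      simp only [GameState.Progress, hi] at this
      exact ⟨i, le_rfl, by simp [this]⟩
    | go next sub ih =>
      intro i hi
      have := hpr i
      simp only [GameState.Progress, hi] at this
      obtain ⟨j, hj, h⟩ := ih _ _ this.2
      exact ⟨j, by omega, h⟩
  have hwmono : Monotone fun i => (st i).1.wit.length :=
    monotone_nat_of_le_succ fun i => (hpr i).wit_prefix.length_le
  have hwlen : ∀ m, ∃ i, m ≤ (st i).1.wit.length := by
    intro m
    induction m with
    | zero => exact ⟨0, zero_le⟩
    | succ m ih =>
      obtain ⟨i, hi⟩ := ih
      obtain ⟨j, hj, h⟩ := hdone _ i rfl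
      have := hwmono hj
      exact ⟨j + 1, by simp only at this; omega⟩
  obtain ⟨f, hf⟩ := exists_limit_of_chain (fun i => (st i).1.pos)
    (fun i => by rw [hposs]; exact List.prefix_append _ _) (fun m => ⟨m, by rw [hlen]; omega⟩)
  obtain ⟨w, hw⟩ := exists_limit_of_chain (fun i => (st i).1.wit) (fun i => (hpr i).wit_prefix)
    hwlen
  have hfk : ∀ i, f (t.length + i) = k (st i) (N i) := by
    intro i
    have h1 := hf i
    have h2 := hf (i + 1)
    simp only [hlen] at h1 h2
    rw [← add_assoc, initSeg_succ, h1, hposs] at h2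
    simpa using List.append_cancel_left h2
  refine ⟨f, w, hf 0, hw 0, fun i => ?_, fun i => ?_, fun m => ?_⟩
  · change _ = (st (i + 1)).1.pos.getLastD 0
    rw [hfk, hposs]
    simp
  · rw [hfk]
    exact hk _ _
  · obtain ⟨i, hi⟩ := hwlen m
    set n := max i m
    obtain ⟨f', hf', hft⟩ := Plan.Valid.nonempty (E := D (st n).1.wit)
      (fun k => by rw [hD (st n).1.wit]; exact Set.subset_iUnion (fun k => D (_ ++ [k])) k)
      _ (st n).2
    refine ⟨(st n).1.pos.length, ?_, (st n).1.wit.length, hi.trans (hwmono (le_max_left _ _)),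
      f', ?_, ?_⟩
    · rw [hlen]
      exact (le_max_right i m).trans (Nat.le_add_left _ _)
    · rwa [hw n]
    · rw [hft, hf n]

/-- If a closed subset of `ℕ^ℕ × ℕ^ℕ` projects onto the first factor, then one of its sections
`w 0 = K` contains in its projection the branches of a Laver tree. -/
theorem exists_laver_strategy {C : Set ((ℕ → ℕ) × (ℕ → ℕ))} (hC : IsClosed C)
    (hproj : ∀ f, ∃ w, (f, w) ∈ C) : ∃ (K : ℕ) (t : List ℕ) (g : List ℕ → ℕ), ∀ N : ℕ → ℕ,
      ∃ f w : ℕ → ℕ, w 0 = K ∧ (f, w) ∈ C ∧ initSeg f t.length = t ∧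
        ∀ i, f (t.length + i) = g (initSeg N (i + 1)) ∧ N i ≤ f (t.length + i) := by
  let D : List ℕ → Set (ℕ → ℕ) := fun u => {f | ∃ w, initSeg w u.length = u ∧ (f, w) ∈ C}
  have hD : ∀ u, D u = ⋃ k, D (u ++ [k]) := by
    intro u
    ext f
    simp only [D, Set.mem_ofPred_eq, Set.mem_iUnion, List.length_append, List.length_singleton,
      initSeg_succ]
    constructor
    · rintro ⟨w, hw, hC⟩
      exact ⟨w u.length, w, by rw [hw], hC⟩
    · rintro ⟨k, w, hw, hC⟩
      exact ⟨w, (List.append_inj' hw rfl).1, hC⟩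
  have hlarge : IsLarge (D []) [] := by
    convert isLarge_univ []
    refine Set.eq_univ_of_forall fun f => ?_
    obtain ⟨w, hw⟩ := hproj f
    exact ⟨w, rfl, hw⟩
  -- One position suffices: it need not be reached in the actual game.
  obtain ⟨t, K, ht⟩ := (hlarge.reach (hD []).subset).nonempty
  obtain ⟨g, hg⟩ := exists_strategy_of_isLarge hD ht
  refine ⟨K, t, g, fun N => ?_⟩
  obtain ⟨f, w, hft, hw, hfg, hfN, hlim⟩ := hg N
  refine ⟨f, w, by simpa [initSeg] using hw, ?_, hft, fun i => ⟨hfg i, hfN i⟩⟩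
  choose i hi j hj f' hf' hff' using hlim
  choose w' hw' hC' using hf'
  simp only [length_initSeg] at hw'
  -- The pairs `(f' m, w' m)` in `C` agree with `(f, w)` on at least `m` coordinates.
  refine hC.mem_of_tendsto (b := atTop) (f := fun m => (f' m, w' m)) ?_ (.of_forall hC')
  refine Tendsto.prodMk_nhds (tendsto_pi_nhds.2 fun n => ?_) (tendsto_pi_nhds.2 fun n => ?_)
  · refine tendsto_const_nhds.congr' ?_
    filter_upwards [eventually_gt_atTop n] with m hm
    exact (eq_of_initSeg_eq (hff' m) (hm.trans_le (hi m))).symm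
  · refine tendsto_const_nhds.congr' ?_
    filter_upwards [eventually_gt_atTop n] with m hm
    exact (eq_of_initSeg_eq (hw' m) (hm.trans_le (hj m))).symm

/-! ### Equivalence of sequences through norms of finite combinations -/

section Domination

variable {𝕜 X : Type*} [RCLike 𝕜] [NormedAddCommGroup X] [NormedSpace 𝕜 X]

variable (𝕜) in
/-- Finite linear combinations of `x` and `y` with the same coefficients have norms which are
equivalent up to the constant `M`. -/
def NormEquivWith (M : ℝ) (x y : ℕ → X) : Prop :=
  ∀ a : ℕ →₀ 𝕜, ‖Finsupp.linearCombination 𝕜 x a‖ ≤ M * ‖Finsupp.linearCombination 𝕜 y a‖ ∧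
    ‖Finsupp.linearCombination 𝕜 y a‖ ≤ M * ‖Finsupp.linearCombination 𝕜 x a‖

theorem NormEquivWith.mono {M N : ℝ} {x y : ℕ → X} (h : NormEquivWith 𝕜 M x y) (hMN : M ≤ N) :
    NormEquivWith 𝕜 N x y := fun a =>
  ⟨(h a).1.trans (by gcongr), (h a).2.trans (by gcongr)⟩

theorem NormEquivWith.trans {M N : ℝ} (hM : 0 ≤ M) (hN : 0 ≤ N) {x y z : ℕ → X}
    (h : NormEquivWith 𝕜 M x y) (h' : NormEquivWith 𝕜 N y z) : NormEquivWith 𝕜 (M * N) x z := by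
  intro a
  constructor
  · calc _ ≤ M * _ := (h a).1
      _ ≤ M * (N * _) := by gcongr; exact (h' a).1
      _ = _ := by ring
  · calc _ ≤ N * _ := (h' a).2
      _ ≤ N * (M * _) := by gcongr; exact (h a).2
      _ = _ := by ring

/-- For fixed coefficients only finitely many vectors occur, so each inequality is a closed
condition. -/
theorem isClosed_normEquivWith :
    IsClosed {p : ℝ × (ℕ → X) × (ℕ → X) | NormEquivWith 𝕜 p.1 p.2.1 p.2.2} := by
  simp only [NormEquivWith, Set.ofPred_forall, Set.ofPred_and, Finsupp.linearCombination_apply,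
    Finsupp.sum]
  exact isClosed_iInter fun a => (isClosed_le (by fun_prop) (by fun_prop)).inter
    (isClosed_le (by fun_prop) (by fun_prop))

variable (𝕜) in
/-- Finite linear combinations of `x`, as elements of the closed linear span. -/
noncomputable def closedSpanCombination (x : ℕ → X) : (ℕ →₀ 𝕜) →ₗ[𝕜] closedSpan 𝕜 x :=
  Finsupp.linearCombination 𝕜 fun i => ⟨x i, mem_closedSpan 𝕜 x i⟩

theorem coe_closedSpanCombination (x : ℕ → X) (a : ℕ →₀ 𝕜) :
    (closedSpanCombination 𝕜 x a : X) = Finsupp.linearCombination 𝕜 x a := by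
  simp [closedSpanCombination, Finsupp.linearCombination_apply, Finsupp.sum]

theorem norm_closedSpanCombination (x : ℕ → X) (a : ℕ →₀ 𝕜) :
    ‖closedSpanCombination 𝕜 x a‖ = ‖Finsupp.linearCombination 𝕜 x a‖ := by
  rw [← coe_closedSpanCombination]; rfl

theorem denseRange_closedSpanCombination (x : ℕ → X) :
    DenseRange (closedSpanCombination 𝕜 x) := by
  rw [DenseRange, Subtype.dense_iff]
  intro z hz
  refine closure_mono ?_ (show z ∈ closure (Submodule.span 𝕜 (Set.range x) : Set X) from hz)
  intro v hv
  obtain ⟨a, rfl⟩ := (Finsupp.mem_span_range_iff_exists_finsupp).1 hv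
  exact ⟨_, ⟨a, rfl⟩, coe_closedSpanCombination x a⟩

theorem SeqEquiv.exists_normEquivWith {x y : ℕ → X} (h : SeqEquiv 𝕜 x y) :
    ∃ M : ℕ, NormEquivWith 𝕜 M x y := by
  obtain ⟨T, hT⟩ := h
  obtain ⟨M, hM⟩ := exists_nat_ge (max ‖(T : closedSpan 𝕜 x →L[𝕜] closedSpan 𝕜 y)‖
    ‖(T.symm : closedSpan 𝕜 y →L[𝕜] closedSpan 𝕜 x)‖)
  have hTa : ∀ a, T (closedSpanCombination 𝕜 x a) = closedSpanCombination 𝕜 y a := fun a => by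
    simp only [closedSpanCombination, Finsupp.linearCombination_apply, Finsupp.sum, map_sum,
      map_smul, hT]
  refine ⟨M, fun a => ?_⟩
  simp only [← norm_closedSpanCombination]
  constructor
  · rw [← hTa]
    conv_lhs => rw [← T.symm_apply_apply (closedSpanCombination 𝕜 x a)]
    exact (T.symm : closedSpan 𝕜 y →L[𝕜] closedSpan 𝕜 x).le_of_opNorm_le
      ((le_max_right _ _).trans hM) _
  · rw [← hTa]
    exact (T : closedSpan 𝕜 x →L[𝕜] closedSpan 𝕜 y).le_of_opNorm_le
      ((le_max_left _ _).trans hM) _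

/-- The identity on coefficients extends by density and completeness; both `T` and its inverse have
norm at most `M`. -/
theorem NormEquivWith.seqEquivConst [CompleteSpace X] {M : ℝ} (hM : 0 ≤ M) {x y : ℕ → X}
    (h : NormEquivWith 𝕜 M x y) : SeqEquivConst 𝕜 (M * M) x y := by
  have : ∀ z : ℕ → X, CompleteSpace (closedSpan 𝕜 z) := fun z =>
    (Submodule.isClosed_topologicalClosure _).completeSpace_coe
  have h₁ : ∀ a, ‖closedSpanCombination 𝕜 y (LinearEquiv.refl 𝕜 _ a)‖ ≤
      M * ‖closedSpanCombination 𝕜 x a‖ := fun a => by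
    simpa only [norm_closedSpanCombination, LinearEquiv.refl_apply, LinearEquiv.refl_symm]
      using (h a).2
  have h₂ : ∀ a, ‖closedSpanCombination 𝕜 x ((LinearEquiv.refl 𝕜 _).symm a)‖ ≤
      M * ‖closedSpanCombination 𝕜 y a‖ := fun a => by
    simpa only [norm_closedSpanCombination, LinearEquiv.refl_apply, LinearEquiv.refl_symm]
      using (h a).1
  have hx := denseRange_closedSpanCombination (𝕜 := 𝕜) x
  have hy := denseRange_closedSpanCombination (𝕜 := 𝕜) y
  have hsingle : ∀ (z : ℕ → X) i,
      closedSpanCombination 𝕜 z (Finsupp.single i 1) = ⟨z i, mem_closedSpan 𝕜 z i⟩ := by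
    simp [closedSpanCombination]
  refine ⟨(LinearEquiv.refl 𝕜 (ℕ →₀ 𝕜)).extend (closedSpanCombination 𝕜 x)
    (closedSpanCombination 𝕜 y) hx ⟨M, h₁⟩ hy ⟨M, h₂⟩, fun i => ?_, ?_⟩
  · rw [← hsingle, LinearEquiv.extend_eq, LinearEquiv.refl_apply, hsingle]
  · refine mul_le_mul ?_ ?_ (norm_nonneg _) hM
    · exact ContinuousLinearMap.opNorm_le_bound _ hM
        (LinearEquiv.norm_extend_le _ _ _ M hx h₁ hy ⟨M, h₂⟩)
    · exact ContinuousLinearMap.opNorm_le_bound _ hM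
        (LinearEquiv.norm_extend_symm_le _ _ _ M hx ⟨M, h₁⟩ hy h₂)

end Domination

/-! ### Block sequences and finite changes -/

section BlockSequences

variable {𝕜 X : Type*} [RCLike 𝕜] [NormedAddCommGroup X] [NormedSpace 𝕜 X]
  {b : SchauderBasis 𝕜 X}

theorem proj_eq_zero {x : X} {p : ℕ} (h : ∀ i ∈ supp b x, p ≤ i) : b.proj p x = 0 := by
  rw [SchauderBasis.proj_apply]
  refine Finset.sum_eq_zero fun i hi => ?_
  by_cases hx : b.coord i x = 0
  · rw [hx, zero_smul]
  · exact absurd (h i hx) (by simpa using hi)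

theorem proj_eq_self {x : X} {p : ℕ} (h : ∀ i ∈ supp b x, i < p) : b.proj p x = x := by
  refine tendsto_nhds_unique (tendsto_const_nhds.congr' ?_) (b.tendsto_proj x)
  filter_upwards [eventually_ge_atTop p] with n hn
  rw [SchauderBasis.proj_apply, SchauderBasis.proj_apply]
  refine Finset.sum_subset (Finset.range_subset_range.2 hn) fun i _ hi => ?_
  by_cases hx : b.coord i x = 0
  · rw [hx, zero_smul]
  · exact absurd (h i hx) (by simpa using hi)

theorem supp_nonempty {x : X} (hx : x ≠ 0) : (supp b x).Nonempty := by
  by_contra h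
  rw [Set.not_nonempty_iff_eq_empty] at h
  apply hx
  rw [← proj_eq_self (b := b) (x := x) (p := 0) (by simp [h])]
  simp

theorem ne_zero_of_mem_bb {x : ℕ → X} (hx : x ∈ bb b) (i : ℕ) : x i ≠ 0 := by
  intro h
  have := hx.2.1 i
  simp [h] at this

theorem vecBelow_of_lt {x : ℕ → X} (hx : x ∈ bb b) {i j : ℕ} (h : i < j) :
    VecBelow b (x i) (x j) := by
  induction j, h using Nat.le_induction with
  | base => exact hx.2.2 i
  | succ j _ ih =>
    intro k hk l hl
    obtain ⟨q, hq⟩ := supp_nonempty (b := b) (ne_zero_of_mem_bb hx j)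
    exact (ih k hk q hq).trans (hx.2.2 j q hq l hl)

theorem exists_proj_linearCombination {x : ℕ → X} (hx : x ∈ bb b) (m : ℕ) :
    ∃ p, ∀ a : ℕ →₀ 𝕜, b.proj p (Finsupp.linearCombination 𝕜 x a) =
      ∑ i ∈ Finset.range m, a i • x i := by
  classical
  have hne := supp_nonempty (b := b) (ne_zero_of_mem_bb hx m)
  -- Cutting at the minimum of the support of `x m` separates the first `m` blocks from the rest.
  refine ⟨sInf (supp b (x m)), fun a => ?_⟩
  have hp : ∀ j, b.proj (sInf (supp b (x m))) (x j) = if j < m then x j else 0 := by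
    intro j
    split_ifs with h
    · exact proj_eq_self fun i hi => vecBelow_of_lt hx h i hi _ (Nat.sInf_mem hne)
    · refine proj_eq_zero fun i hi => ?_
      rcases (not_lt.1 h).eq_or_lt with rfl | h
      · exact Nat.sInf_le hi
      · exact (vecBelow_of_lt hx h _ (Nat.sInf_mem hne) i hi).le
  induction a using Finsupp.induction_linear with
  | zero => simp
  | add a a' h h' => simp only [map_add, h, h', Finsupp.add_apply, add_smul, Finset.sum_add_distrib]
  | single j c =>
    rw [Finsupp.linearCombination_single, map_smul, hp]
    simp [Finsupp.single_apply, ite_smul]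

/-- The `i`-th term is a difference of two basis projections. -/
theorem norm_coeff_le {B : ℝ} (hB : ∀ n, ‖b.proj n‖ ≤ B) {x : ℕ → X} (hx : x ∈ bb b)
    (a : ℕ →₀ 𝕜) (i : ℕ) : ‖a i‖ ≤ 2 * B * ‖Finsupp.linearCombination 𝕜 x a‖ := by
  obtain ⟨p, hp⟩ := exists_proj_linearCombination hx i
  obtain ⟨q, hq⟩ := exists_proj_linearCombination hx (i + 1)
  have h := hq a
  rw [Finset.sum_range_succ, ← hp a] at h
  calc ‖a i‖ = ‖a i • x i‖ := by rw [norm_smul, hx.2.1 i, mul_one]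
    _ = ‖b.proj q (Finsupp.linearCombination 𝕜 x a) -
        b.proj p (Finsupp.linearCombination 𝕜 x a)‖ := by rw [h, add_sub_cancel_left]
    _ ≤ _ := norm_sub_le _ _
    _ ≤ B * _ + B * _ := add_le_add ((b.proj q).le_of_opNorm_le (hB q) _)
        ((b.proj p).le_of_opNorm_le (hB p) _)
    _ = _ := by ring

theorem norm_linearCombination_le_of_eventually_eq {B : ℝ} (hB : ∀ n, ‖b.proj n‖ ≤ B)
    {x y : ℕ → X} (hx : x ∈ bb b) (hy : y ∈ bb b) {m : ℕ} (h : ∀ i, m ≤ i → x i = y i)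
    (a : ℕ →₀ 𝕜) : ‖Finsupp.linearCombination 𝕜 y a‖ ≤
      (1 + 4 * B * m) * ‖Finsupp.linearCombination 𝕜 x a‖ := by
  have hdiff : Finsupp.linearCombination 𝕜 y a = Finsupp.linearCombination 𝕜 x a +
      ∑ i ∈ Finset.range m, a i • (y i - x i) := by
    classical
    induction a using Finsupp.induction_linear with
    | zero => simp
    | add a a' h h' =>
      simp only [map_add, h, h', Finsupp.add_apply, add_smul, Finset.sum_add_distrib]
      abel
    | single j c =>
      simp only [Finsupp.linearCombination_single, Finsupp.single_apply, ite_smul, zero_smul,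
        Finset.sum_ite_eq, Finset.mem_range]
      split_ifs with hj
      · rw [smul_sub]; abel
      · rw [h j (not_lt.1 hj), add_zero]
  rw [hdiff]
  refine (norm_add_le _ _).trans ?_
  -- The factor `2 * B` bounds a coefficient and the last `2` bounds `‖y i - x i‖`; `m` terms give
  -- `4 * B * m`.
  have hsum : ‖∑ i ∈ Finset.range m, a i • (y i - x i)‖ ≤
      ∑ i ∈ Finset.range m, 2 * B * ‖Finsupp.linearCombination 𝕜 x a‖ * 2 := by
    refine norm_sum_le_of_le _ fun i _ => ?_
    rw [norm_smul]
    refine mul_le_mul (norm_coeff_le hB hx a i) ?_ (norm_nonneg _)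
      ((norm_nonneg _).trans (norm_coeff_le hB hx a i))
    refine (norm_sub_le _ _).trans ?_
    rw [hx.2.1 i, hy.2.1 i]
    norm_num
  rw [Finset.sum_const, Finset.card_range, nsmul_eq_mul] at hsum
  linarith

/-- Normalised block sequences which agree from `m` on are equivalent, with a constant that depends
only on `m` and on a bound for the basis projections. -/
theorem normEquivWith_of_eventually_eq {B : ℝ} (hB : ∀ n, ‖b.proj n‖ ≤ B)
    {x y : ℕ → X} (hx : x ∈ bb b) (hy : y ∈ bb b) {m : ℕ} (h : ∀ i, m ≤ i → x i = y i) :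
    NormEquivWith 𝕜 (1 + 4 * B * m) x y := fun a =>
  ⟨norm_linearCombination_le_of_eventually_eq hB hy hx (fun i hi => (h i hi).symm) a,
    norm_linearCombination_le_of_eventually_eq hB hx hy h a⟩

theorem basis_ne_zero (b : SchauderBasis 𝕜 X) (i : ℕ) : b i ≠ 0 :=
  b.linearIndependent.ne_zero i

/-- The normalised basis vectors. -/
noncomputable def normalizedBasis (b : SchauderBasis 𝕜 X) (i : ℕ) : X :=
  ((‖b i‖⁻¹ : ℝ) : 𝕜) • b i

theorem norm_normalizedBasis (i : ℕ) : ‖normalizedBasis b i‖ = 1 := by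
  rw [normalizedBasis, norm_smul, RCLike.norm_ofReal, abs_of_nonneg (by positivity),
    inv_mul_cancel₀ (norm_ne_zero_iff.2 (basis_ne_zero b i))]

theorem normalizedBasis_mem_span (i : ℕ) :
    normalizedBasis b i ∈ Submodule.span 𝕜 (Set.range b) :=
  Submodule.smul_mem _ _ (Submodule.subset_span ⟨i, rfl⟩)

theorem eq_of_mem_supp_normalizedBasis {i j : ℕ} (h : j ∈ supp b (normalizedBasis b i)) :
    j = i := by
  by_contra hne
  apply h
  simp [normalizedBasis, b.ortho, hne]

end BlockSequences

/-! ### Strategies and the transfer to the real game -/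

section Strategies

variable {X : Type*}

theorem outcome_eq (σ : List ℕ → X) (n : ℕ → ℕ) (i : ℕ) :
    outcome σ n i = σ (initSeg n (i + 1)) := rfl

theorem outcome_congr (σ : List ℕ → X) {n n' : ℕ → ℕ} {i : ℕ} (h : ∀ j ≤ i, n j = n' j) :
    outcome σ n i = outcome σ n' i := by
  rw [outcome_eq, outcome_eq, initSeg_congr fun j hj => h j (by omega)]

/-- Non-anticipating functions are given by strategies. -/
theorem exists_strategy_of_nonanticipating {Φ : (ℕ → ℕ) → ℕ → X}
    (h : ∀ n n' i, (∀ j ≤ i, n j = n' j) → Φ n i = Φ n' i) :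
    ∃ σ : List ℕ → X, ∀ n, outcome σ n = Φ n := by
  refine ⟨fun l => Φ (fun j => l.getD j 0) (l.length - 1), fun n => funext fun i => ?_⟩
  rw [outcome_eq, length_initSeg, Nat.add_sub_cancel]
  exact h _ _ _ fun j hj => getD_initSeg n (by omega)

theorem continuous_outcome [TopologicalSpace X] (σ : List ℕ → X) : Continuous (outcome σ) := by
  refine continuous_pi fun i => ?_
  have : (fun n => outcome σ n i) = (fun v : Fin (i + 1) → ℕ => σ (List.ofFn v)) ∘
      fun (n : ℕ → ℕ) (j : Fin (i + 1)) => n j := by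
    ext n
    simp only [outcome_eq, Function.comp_apply]
    congr 1
    exact List.ext_getElem (by simp) fun j _ _ => by
      rw [getElem_initSeg, List.getElem_ofFn]
  rw [this]
  exact continuous_of_discreteTopology.comp (by fun_prop)

end Strategies

/-- A lower bound for the supports in the `i`-th move, strictly increasing in `i`. -/
def moveBound (n : ℕ → ℕ) (i : ℕ) : ℕ := ∑ j ∈ Finset.range (i + 1), (n j + 1)

theorem moveBound_congr {n n' : ℕ → ℕ} {i : ℕ} (h : ∀ j ≤ i, n j = n' j) :
    moveBound n i = moveBound n' i :=
  Finset.sum_congr rfl fun j hj => by rw [h j (by simpa [Nat.lt_succ_iff] using hj)]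

theorem lt_moveBound (n : ℕ → ℕ) (i : ℕ) : n i < moveBound n i := by
  rw [moveBound, Finset.sum_range_succ]; omega

theorem moveBound_lt_succ (n : ℕ → ℕ) (i : ℕ) : moveBound n i < moveBound n (i + 1) := by
  conv_rhs => rw [moveBound, Finset.sum_range_succ]
  exact lt_add_of_pos_right _ (Nat.succ_pos _)

/-- The moves fed to player II's strategy: first `t`, then the answers of `g` to the bounds
`moveBound n`. -/
def fedMoves (t : List ℕ) (g : List ℕ → ℕ) (n : ℕ → ℕ) (i : ℕ) : ℕ :=
  if i < t.length then t.getD i 0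
  else g (initSeg (fun k => moveBound n (t.length + k)) (i - t.length + 1))

theorem fedMoves_congr (t : List ℕ) (g : List ℕ → ℕ) {n n' : ℕ → ℕ} {i : ℕ}
    (h : ∀ j ≤ i, n j = n' j) : fedMoves t g n i = fedMoves t g n' i := by
  unfold fedMoves
  split_ifs with hi
  · rfl
  · rw [initSeg_congr fun k hk => moveBound_congr fun j hj => h j (by omega)]

variable {𝕜 X : Type*} [RCLike 𝕜] [NormedAddCommGroup X] [NormedSpace 𝕜 X]

/-- Replacing the vectors before `m` of a run by normalised basis vectors whose indices are large
enough gives a run, provided that the later vectors are supported high enough. -/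
theorem isRun_of_initial_basis {b : SchauderBasis 𝕜 X} {x : ℕ → X} (hx : x ∈ bb b) (m : ℕ)
    {n : ℕ → ℕ} (h : ∀ i, m ≤ i → NatBelow b (moveBound n i) (x i)) :
    IsRun b n fun i => if i < m then normalizedBasis b (moveBound n i) else x i := by
  refine ⟨⟨fun i => ?_, fun i => ?_, fun i => ?_⟩, fun i => ?_⟩ <;> dsimp only
  · split_ifs
    exacts [normalizedBasis_mem_span _, hx.1 i]
  · split_ifs
    exacts [norm_normalizedBasis _, hx.2.1 i]
  · by_cases h1 : i + 1 < m
    · rw [if_pos h1, if_pos (by omega)]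
      intro k hk l hl
      rw [eq_of_mem_supp_normalizedBasis hk, eq_of_mem_supp_normalizedBasis hl]
      exact moveBound_lt_succ n i
    rw [if_neg h1]
    split_ifs with h2
    · intro k hk l hl
      rw [eq_of_mem_supp_normalizedBasis hk]
      exact (moveBound_lt_succ n i).trans (h _ (not_lt.1 h1) l hl)
    · exact hx.2.2 i
  · split_ifs with hi
    · intro k hk
      rw [eq_of_mem_supp_normalizedBasis hk]
      exact lt_moveBound n i
    · exact fun k hk => (lt_moveBound n i).trans (h i (not_lt.1 hi) k hk)

/-- If player II can play in the saturation of an analytic set, then player II can do so with a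
uniform constant. -/
theorem exists_iiHasStrategy_saturationConst [CompleteSpace X] (b : SchauderBasis 𝕜 X) (A : Set (ℕ → X))
    (hA' : AnalyticSet A)
    (hII : IIHasStrategy b (saturation b A)) :
    ∃ K : ℝ, 1 ≤ K ∧
      IIHasStrategy b (saturationConst b K A) := by
  obtain ⟨σ, hσ⟩ := hII
  rw [AnalyticSet] at hA'
  rcases hA' with rfl | ⟨F, hF, rfl⟩
  · obtain ⟨-, -, y, hy, -⟩ := hσ 0
    exact hy.elim
  obtain ⟨B, hB⟩ := b.exists_norm_proj_le
  have hB0 : 0 ≤ B := (norm_nonneg _).trans (hB 0)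
  have hC : IsClosed {p : (ℕ → ℕ) × (ℕ → ℕ) |
      NormEquivWith 𝕜 (p.2 0) (outcome σ p.1) (F fun i => p.2 (i + 1))} := by
    have hcont : Continuous fun p : (ℕ → ℕ) × (ℕ → ℕ) =>
        (((p.2 0 : ℕ) : ℝ), outcome σ p.1, F fun i => p.2 (i + 1)) := by
      refine .prodMk ?_ (.prodMk ?_ ?_)
      · exact (continuous_of_discreteTopology (f := fun k : ℕ => (k : ℝ))).comp (by fun_prop)
      · exact (continuous_outcome σ).comp continuous_fst
      · exact hF.comp (by fun_prop)
    exact (isClosed_normEquivWith (𝕜 := 𝕜)).preimage hcont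
  obtain ⟨K, t, g, hg⟩ := exists_laver_strategy hC fun n => by
    obtain ⟨-, -, -, ⟨w, rfl⟩, hw⟩ := hσ n
    obtain ⟨M, hM⟩ := hw.exists_normEquivWith
    -- Digit `0` carries the constant; the code of the member of `A` is shifted by one.
    exact ⟨fun i => if i = 0 then M else w (i - 1), by simpa using hM⟩
  set L : ℝ := (1 + 4 * B * t.length) * K
  have hL : 0 ≤ L := by positivity
  obtain ⟨τ, hτ⟩ := exists_strategy_of_nonanticipating (Φ := fun n i =>
      if i < t.length then normalizedBasis b (moveBound n i) else outcome σ (fedMoves t g n) i)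
    fun n n' i h => by
      rw [moveBound_congr h,
        outcome_congr σ fun j hj => fedMoves_congr t g fun k hk => h k (hk.trans hj)]
  refine ⟨max 1 (L * L), le_max_left _ _, τ, fun n => ?_⟩
  rw [hτ]
  -- The bounds start at move `t.length`, where `σ` takes over from the basis vectors; `rfl`
  -- identifies `K` with `w 0`.
  obtain ⟨f, w, rfl, hfw, hft, hfg⟩ := hg fun k => moveBound n (t.length + k)
  have hfed : fedMoves t g n = f := by
    ext i
    unfold fedMoves
    split_ifs with hi
    · rw [initSeg_eq_iff.1 hft i hi, List.getD_eq_getElem _ _ hi]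
    · rw [← (hfg _).1, Nat.add_sub_cancel' (not_lt.1 hi)]
  rw [hfed]
  obtain ⟨⟨hbb, hrun⟩, -⟩ := hσ f
  have hR := isRun_of_initial_basis (n := n) hbb t.length fun i hi k hk => by
    have h1 := (hfg (i - t.length)).2
    rw [Nat.add_sub_cancel' hi] at h1
    exact h1.trans_lt (hrun i k hk)
  have heq := (normEquivWith_of_eventually_eq hB hR.1 hbb (m := t.length) fun i hi =>
    if_neg (not_lt.2 hi)).trans (by positivity) (by positivity) hfw
  obtain ⟨T, hT, hTL⟩ := heq.seqEquivConst hL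
  exact ⟨hR, hR.1, _, ⟨fun i => w (i + 1), rfl⟩, T, hT, hTL.trans (le_max_right _ _)⟩

end AsymptoticGame

theorem mainTheorem11 {𝕜 X : Type*} [RCLike 𝕜] [NormedAddCommGroup X] [NormedSpace 𝕜 X]
    [CompleteSpace X] (b : SchauderBasis 𝕜 X) (A : Set (ℕ → X))
    (hA : A ⊆ AsymptoticGame.bb b) (hA' : AnalyticSet A)
    (hII : AsymptoticGame.IIHasStrategy b (AsymptoticGame.saturation b A)) :
    ∃ K : ℝ, 1 ≤ K ∧
      AsymptoticGame.IIHasStrategy b (AsymptoticGame.saturationConst b K A) :=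
  AsymptoticGame.exists_iiHasStrategy_saturationConst b A hA' hII
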